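/- Let $P(s)$ and $G(s)$ be real rational transfer functions (plant and controller) connected in the standard unity feedback loop with loop function $L=PG$, and assume that no pole of $P$ or $G$ in the closed right half plane is cancelled in the product $PG$. Let $n\ge 0$ be the number of poles of $L$ with positive real part, counted with multiplicity. The closed loop is called stable if all its poles, i.e. all zeros of the numerator of $Q=1+L$ taken over the product of the denominators of $P$ and $G$, have negative real part. For $R,\varepsilon>0$ let $\Gamma=\Gamma_{R,\varepsilon}$ be the standard Nyquist contour: it runs from $-iR$ to $iR$ along the imaginary axis, passing each pole of $L$ on that axis on the right along a semicircle of radius $\varepsilon$, and returns clockwise along the semicircle $|s|=R$, $\operatorname{Re}s\ge 0$. The Nyquist plot is the closed curve $t\mapsto f(t)=L(\Gamma(t))$. The multiple-sheeted Nichols plot is the curve of the points $(\varphi(t),\,20\log_{10}|f(t)|\,\mathrm{dB})$ for those $t$ with $f(t)\neq 0$, where $\varphi$ is an unwrapped phase of $f$ in degrees, i.e. $f=|f|e^{i\pi\varphi/180}$ with $\varphi$ continuous wherever $f\ne0$. A crossing occurs where this plot meets one of the rays $\{\varphi=(-180+360k)^\circ,\ r>0\,\mathrm{dB}\}$, $k\in\mathbb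 Z$. It counts $+1$ if the plot passes the ray from right to left (phase decreasing), $-1$ if from left to right, and $0$ if the plot only touches the ray and turns back; if the plot runs along a ray for a while, entering and leaving the ray count one half each. Encirclements of $-1$ by the Nyquist plot are counted $+1$ if clockwise and $-1$ if counterclockwise. Then for all sufficiently large $R$ and all sufficiently small $\varepsilon>0$ an unwrapped phase $\varphi$ exists, and for every such $\varphi$ there are only finitely many $t$ in one turn of $\Gamma$ at which the crossing is nonzero, and: 1. if the Nyquist plot does not pass through $-1$, the sum of the crossings with all the rays during one turn equals the number of encirclements of $-1$ by the Nyquist plot of $L$; 2. the closed loop is stable if and only if the Nichols plot does not pass through any of the critical points $((-180+360k)^\circ,0\,\mathrm{dB})$, $k\in\mathbb Z$, and the sum of the crossings with all the rays equals $-n$. -/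

import Mathlib

open Filter Topology

noncomputable section

namespace NicholsChart

/-! ### The feedback system -/

/-- No cancellation, in the closed right half plane, between a zero and a pole in the product
`P(s) G(s)` of plant and controller. -/
def NoUnstableCancellation (P G : RatFunc ℝ) : Prop :=
  ∀ s : ℂ, 0 ≤ s.re →
    ¬ (Polynomial.aeval s (P.num * G.num) = 0 ∧ Polynomial.aeval s (P.denom * G.denom) = 0)

/-- The numerator of the characteristic function `Q = 1 + P G`, written over the common
denominator `P.denom * G.denom`; its zeros are the closed-loop poles. -/
def characteristicPolynomial (P G : RatFunc ℝ) : Polynomial ℝ :=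
  P.denom * G.denom + P.num * G.num

/-- The closed loop is stable: all its poles lie in the open left half plane. -/
def ClosedLoopStable (P G : RatFunc ℝ) : Prop :=
  ∀ s : ℂ, Polynomial.aeval s (characteristicPolynomial P G) = 0 → s.re < 0

/-- Number of poles of `L` in the open right half plane, with multiplicity. -/
def unstablePoleCount (L : RatFunc ℝ) : ℕ :=
  (L.denom.aroots ℂ).countP (fun s => 0 < s.re)

/-- The distinct poles of `L` on the imaginary axis. -/
def imaginaryPoles (L : RatFunc ℝ) : Finset ℂ :=
  (L.denom.aroots ℂ).toFinset.filter (fun s => s.re = 0)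

/-! ### The Nyquist contour and the Nyquist plot -/

/-- Real part, at height `ω`, of the indented imaginary axis: around each pole `p` on the axis the
path follows the right half of the circle of radius `ε` centred at `p`, elsewhere it stays on the
axis (`Real.sqrt` is `0` at negative arguments). -/
def detour (L : RatFunc ℝ) (ε ω : ℝ) : ℝ :=
  ∑ p ∈ imaginaryPoles L, Real.sqrt (ε ^ 2 - (ω - p.im) ^ 2)

/-- The standard Nyquist contour, traversed clockwise, as a map of period `1`: first up the
indented imaginary axis from `-iR` to `iR`, then back along the half circle of radius `R` in the
right half plane. -/
def nyquistContour (L : RatFunc ℝ) (R ε t : ℝ) : ℂ :=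
  if Int.fract t ≤ 1 / 2 then
    (detour L ε (R * (4 * Int.fract t - 1)) : ℂ)
      + ((R * (4 * Int.fract t - 1) : ℝ) : ℂ) * Complex.I
  else
    (R : ℂ) * Complex.exp (((Real.pi * (3 / 2 - 2 * Int.fract t) : ℝ) : ℂ) * Complex.I)

/-- The Nyquist plot: the image of the Nyquist contour under `L`. -/
def nyquistPlot (L : RatFunc ℝ) (R ε t : ℝ) : ℂ :=
  RatFunc.eval (algebraMap ℝ ℂ) (nyquistContour L R ε t) L

/-- The closed curve `f` (of period `1`) avoids `z` and encircles it `N` times, a clockwise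
encirclement counting `+1` and a counterclockwise one `-1`. -/
def Encircles (f : ℝ → ℂ) (z : ℂ) (N : ℤ) : Prop :=
  (∀ t, f t ≠ z) ∧ ∃ ψ : ℝ → ℝ, Continuous ψ ∧
    (∀ t, f t - z = (‖f t - z‖ : ℂ) * Complex.exp ((ψ t : ℂ) * Complex.I)) ∧
    ψ 0 - ψ 1 = 2 * Real.pi * N

/-! ### The multiple-sheeted Nichols plot -/

/-- Magnitude in decibels (of a nonzero number). -/
def decibel (z : ℂ) : ℝ := 20 * Real.logb 10 ‖z‖

/-- `φ` is an unwrapped phase, in degrees, of the curve `f`. Points where `f` vanishes have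
magnitude `-∞` dB and no phase, hence do not appear in the Nichols chart. The multiple-sheeted
Nichols plot consists of the points `(φ t, decibel (f t))` with `f t ≠ 0`. -/
structure IsUnwrappedPhase (f : ℝ → ℂ) (φ : ℝ → ℝ) : Prop where
  phase : ∀ t, f t ≠ 0 →
    f t = (‖f t‖ : ℂ) * Complex.exp (((φ t * Real.pi / 180 : ℝ) : ℂ) * Complex.I)
  continuousAt : ∀ t, f t ≠ 0 → ContinuousAt φ t

/-- The Nichols plot passes through some critical point `((-180 + 360 k)°, 0 dB)`. -/
def MeetsCriticalPoint (f : ℝ → ℂ) (φ : ℝ → ℝ) : Prop :=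
  ∃ t, f t ≠ 0 ∧ decibel (f t) = 0 ∧ ∃ k : ℤ, φ t = -180 + 360 * k

/-- At `t` the Nichols plot is on some ray of phase `(-180 + 360 k)°` and magnitude `> 0 dB`. -/
def OnRay (f : ℝ → ℂ) (φ : ℝ → ℝ) (t : ℝ) : Prop :=
  f t ≠ 0 ∧ 0 < decibel (f t) ∧ ∃ k : ℤ, φ t = -180 + 360 * k

open Classical in
/-- The side of the vertical line through `(φ t, ·)` on which the plot runs along `l` (just before
or just after `t`): `1` on the right, `-1` on the left, `0` if on neither. -/
def side (φ : ℝ → ℝ) (l : Filter ℝ) (t : ℝ) : ℤ :=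
  if ∀ᶠ u in l, φ t < φ u then 1
  else if ∀ᶠ u in l, φ u < φ t then -1
  else 0

open Classical in
/-- The signed crossing at `t`: `+1` if the plot passes a ray from right to left, `-1` from left to
right, `0` if it touches the ray and turns back. If the plot runs along a ray for a while, entering
and leaving it count one half each. -/
def crossing (f : ℝ → ℂ) (φ : ℝ → ℝ) (t : ℝ) : ℚ :=
  if OnRay f φ t then ((side φ (𝓝[<] t) t - side φ (𝓝[>] t) t : ℤ) : ℚ) / 2 else 0

/-- The sum of the crossings, over all rays, during one turn of the closed curve. -/
def crossingSum (f : ℝ → ℂ) (φ : ℝ → ℝ) : ℚ :=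
  ∑ᶠ t ∈ Set.Ico (0 : ℝ) 1, crossing f φ t

end NicholsChart

end

/-!
The Nyquist plot `f = L ∘ Γ` meets a critical ray of the Nichols chart exactly when `f` is real and
less than `-1`, that is, when `f + 1` is on the negative real axis. There `f` and `f + 1` have the
same imaginary part, so a phase `φ` of `f` and a phase `ψ` of `f + 1` leave the ray on the same side
(`eventually_im_sign_iff`). Hence the crossing at `t` is the jump, up to sign, of the rounded phase
`symmFloor (ψ / 2π + 1 / 2)`; rounding with mean values at the integers produces the half counts for
entering and leaving a ray. The rounded phase is a step function, its jumps telescope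
(`finsum_jumps`), and over one period it changes by the winding number of `f` around `-1`
(`IsUnwrappedPhase.crossingSum_eq`).

What makes the crossings finite in number, and the phases one-sidedly monotone where it matters, is
that the contour consists of analytic arcs: on each side of each parameter value, `Im f` is
eventually positive, negative or identically zero (`Clear.hasSign_nyquistPlot`). Circular
indentations are given in Cartesian form, so they are reparametrized by the arcsine.

No residue calculus is needed to count encirclements. The function `1 + L` is a quotient of products
of linear factors `Γ - z`, phases of products add, and each factor has an explicit phase: the
principal argument when `Re z ≤ 0`, as `Γ - z` then stays off the branch cut, and two principal
arguments glued at `± iR` when `z` is enclosed (`Clear.exists_isPhase_sub`). So `f` encircles `-1`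
exactly `Z - n` times, `Z` being the number of zeros of `1 + L` in the open right half plane. Zeros
of `1 + L` on the imaginary axis are on the contour, and factors that cancel in `P G` have no zeros
in the closed right half plane; thus the loop is stable if and only if `f` avoids `-1` and `Z = 0`
(`stable_iff`).
-/

namespace NicholsChart

/-! ### Continuous phases and their turn counts -/

/-- `θ` is a phase, in radians, of the curve `g`: it is continuous wherever `g ≠ 0` and decreases
by exactly `2 π m` over each period, so `m` counts clockwise turns around `0`. Zeros of `g` are
allowed; there the polar equation is trivial and continuity is not required. -/
structure IsPhase (g : ℝ → ℂ) (θ : ℝ → ℝ) (m : ℤ) : Prop where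
  polar : ∀ t, g t = (‖g t‖ : ℂ) * Complex.exp ((θ t : ℂ) * Complex.I)
  continuousAt : ∀ t, g t ≠ 0 → ContinuousAt θ t
  turn : ∀ t, θ (t + 1) = θ t - 2 * Real.pi * m

namespace IsPhase

variable {g h : ℝ → ℂ} {θ η : ℝ → ℝ} {m k : ℤ}

theorem const (c : ℂ) : IsPhase (fun _ => c) (fun _ => c.arg) 0 where
  polar _ := (Complex.norm_mul_exp_arg_mul_I c).symm
  continuousAt _ _ := continuousAt_const
  turn _ := by simp

theorem mul (hg : IsPhase g θ m) (hh : IsPhase h η k) :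
    IsPhase (fun t => g t * h t) (fun t => θ t + η t) (m + k) where
  polar t := by
    conv_lhs => rw [hg.polar t, hh.polar t]
    push_cast [norm_mul]
    rw [add_mul, Complex.exp_add]
    ring
  continuousAt t ht :=
    (hg.continuousAt t (left_ne_zero_of_mul ht)).add (hh.continuousAt t (right_ne_zero_of_mul ht))
  turn t := by
    rw [hg.turn, hh.turn]
    push_cast
    ring

theorem inv (hg : IsPhase g θ m) : IsPhase (fun t => (g t)⁻¹) (fun t => -θ t) (-m) where
  polar t := by
    conv_lhs => rw [hg.polar t]
    push_cast [norm_inv]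
    rw [neg_mul, Complex.exp_neg, mul_inv]
  continuousAt t ht := (hg.continuousAt t (by simpa using ht)).neg
  turn t := by
    rw [hg.turn]
    push_cast
    ring

end IsPhase

theorem exists_isPhase_multiset_prod (Γ : ℝ → ℂ) (s : Multiset ℂ)
    (hs : ∀ z ∈ s, ∃ θ, IsPhase (fun t => Γ t - z) θ (if 0 < z.re then 1 else 0)) :
    ∃ θ, IsPhase (fun t => (s.map fun z => Γ t - z).prod) θ (s.countP fun z => 0 < z.re) := by
  classical
  induction s using Multiset.induction_on with
  | empty => exact ⟨_, by simpa using IsPhase.const 1⟩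
  | cons a s ih =>
    obtain ⟨θ, hθ⟩ := hs a (Multiset.mem_cons_self a s)
    obtain ⟨η, hη⟩ := ih fun z hz => hs z (Multiset.mem_cons_of_mem hz)
    refine ⟨fun t => θ t + η t, ?_⟩
    have := hθ.mul hη
    simp only [Multiset.map_cons, Multiset.prod_cons, Multiset.countP_cons]
    convert this using 1
    split_ifs <;> push_cast <;> ring

/-- A polynomial along a curve turns once for each root around which the curve turns. -/
theorem exists_isPhase_eval (Γ : ℝ → ℂ) (p : Polynomial ℂ)
    (hs : ∀ z ∈ p.roots, ∃ θ, IsPhase (fun t => Γ t - z) θ (if 0 < z.re then 1 else 0)) :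
    ∃ θ, IsPhase (fun t => p.eval (Γ t)) θ (p.roots.countP fun z => 0 < z.re) := by
  obtain ⟨θ, hθ⟩ := exists_isPhase_multiset_prod Γ p.roots hs
  have h := (IsPhase.const p.leadingCoeff).mul hθ
  refine ⟨fun t => p.leadingCoeff.arg + θ t, ?_⟩
  convert h using 1
  · funext t
    exact (IsAlgClosed.splits p).eval_eq_prod_roots _
  · simp

/-! ### Geometry of the Nyquist contour -/

/-- The contour is clear of the finite set `S`, which contains the poles: each point of `S` in the
open right half plane is inside the contour, and on the imaginary axis each indentation is far from
all points of `S` except its own centre. -/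
structure Clear (L : RatFunc ℝ) (S : Finset ℂ) (R ε : ℝ) : Prop where
  eps_pos : 0 < ε
  eps_lt : ε < R
  poles_mem : ∀ z : ℂ, Polynomial.aeval z L.denom = 0 → z ∈ S
  separated : ∀ p ∈ imaginaryPoles L, ∀ z ∈ S, z.re = 0 → z ≠ p → 2 * ε < |z.im - p.im|
  lt_re : ∀ z ∈ S, 0 < z.re → ε < z.re
  norm_lt : ∀ z ∈ S, ‖z‖ + ε < R

theorem exists_clear (L : RatFunc ℝ) (S : Finset ℂ)
    (hS : ∀ z : ℂ, Polynomial.aeval z L.denom = 0 → z ∈ S) :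
    ∃ R₀ : ℝ, 0 < R₀ ∧ ∃ ε₀ : ℝ, 0 < ε₀ ∧
      ∀ R : ℝ, R₀ < R → ∀ ε : ℝ, 0 < ε → ε < ε₀ → Clear L S R ε := by
  have hp : ∀ p ∈ imaginaryPoles L, p.re = 0 := fun p hp => (Finset.mem_filter.1 hp).2
  have h0 : Tendsto (fun ε : ℝ => 2 * ε) (𝓝[>] 0) (𝓝 0) := by
    have : Tendsto (fun ε : ℝ => 2 * ε) (𝓝 0) (𝓝 (2 * 0)) := tendsto_id.const_mul 2
    simpa using this.mono_left nhdsWithin_le_nhds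
  have hsep : ∀ᶠ ε : ℝ in 𝓝[>] 0, ∀ p ∈ imaginaryPoles L, ∀ z ∈ S, z.re = 0 → z ≠ p →
      2 * ε < |z.im - p.im| := by
    rw [Filter.eventually_all_finset]
    intro p hpm
    rw [Filter.eventually_all_finset]
    intro z _
    by_cases hz : z.re = 0 ∧ z ≠ p
    · have : 0 < |z.im - p.im| := abs_pos.2 fun h =>
        hz.2 (Complex.ext (hz.1.trans (hp p hpm).symm) (sub_eq_zero.1 h))
      filter_upwards [h0.eventually_lt_const this] with ε hε _ _ using hε
    · exact Eventually.of_forall fun ε h1 h2 => absurd ⟨h1, h2⟩ hz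
  have hre : ∀ᶠ ε : ℝ in 𝓝[>] 0, ∀ z ∈ S, 0 < z.re → 2 * ε < z.re := by
    rw [Filter.eventually_all_finset]
    intro z _
    by_cases hz : 0 < z.re
    · filter_upwards [h0.eventually_lt_const hz] with ε hε _ using hε
    · exact Eventually.of_forall fun ε h => absurd h hz
  have hone : ∀ᶠ ε : ℝ in 𝓝[>] 0, 2 * ε < 1 := h0.eventually_lt_const one_pos
  have hnorm : ∀ᶠ R : ℝ in atTop, ∀ z ∈ S, ‖z‖ + 1 < R := by
    rw [Filter.eventually_all_finset]
    exact fun z _ => eventually_gt_atTop _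
  obtain ⟨R₀, hR, hR1⟩ := (hnorm.and (eventually_gt_atTop 1)).exists
  obtain ⟨ε₀, ⟨⟨h1, h2⟩, h3⟩, h4⟩ :=
    (((hsep.and hre).and hone).and self_mem_nhdsWithin).exists
  have h4 : 0 < ε₀ := h4
  refine ⟨R₀, by linarith, ε₀, h4, fun R hRR ε hε hεε => ⟨hε, by linarith, hS, ?_, ?_, ?_⟩⟩
  · intro p hp z hz hz0 hzp
    linarith [h1 p hp z hz hz0 hzp]
  · intro z hz hz0
    linarith [h2 z hz hz0]
  · intro z hz
    linarith [hR z hz]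

/-- The indented imaginary axis, parametrized by height. -/
noncomputable def axisPath (L : RatFunc ℝ) (ε ω : ℝ) : ℂ := (detour L ε ω : ℂ) + (ω : ℂ) * Complex.I

/-- The closing half circle, parametrized on `[1 / 2, 1]`; it turns clockwise from `i R` to
`-i R`. -/
noncomputable def arcPath (R x : ℝ) : ℂ :=
  (R : ℂ) * Complex.exp (((Real.pi * (3 / 2 - 2 * x) : ℝ) : ℂ) * Complex.I)

theorem nyquistContour_of_le {L : RatFunc ℝ} {R ε t : ℝ} (ht : Int.fract t ≤ 1 / 2) :
    nyquistContour L R ε t = axisPath L ε (R * (4 * Int.fract t - 1)) := if_pos ht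

theorem nyquistContour_of_lt {L : RatFunc ℝ} {R ε t : ℝ} (ht : 1 / 2 < Int.fract t) :
    nyquistContour L R ε t = arcPath R (Int.fract t) := if_neg ht.not_ge

theorem nyquistContour_add_one (L : RatFunc ℝ) (R ε t : ℝ) :
    nyquistContour L R ε (t + 1) = nyquistContour L R ε t := by
  simp [nyquistContour]

@[simp] theorem axisPath_re (L : RatFunc ℝ) (ε ω : ℝ) : (axisPath L ε ω).re = detour L ε ω := by
  simp [axisPath]

@[simp] theorem axisPath_im (L : RatFunc ℝ) (ε ω : ℝ) : (axisPath L ε ω).im = ω := by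
  simp [axisPath]

theorem continuous_detour (L : RatFunc ℝ) (ε : ℝ) : Continuous (detour L ε) := by
  unfold detour
  fun_prop

theorem continuous_axisPath (L : RatFunc ℝ) (ε : ℝ) : Continuous (axisPath L ε) := by
  have := continuous_detour L ε
  unfold axisPath
  fun_prop

theorem continuous_arcPath (R : ℝ) : Continuous (arcPath R) := by
  unfold arcPath
  fun_prop

theorem detour_nonneg (L : RatFunc ℝ) (ε ω : ℝ) : 0 ≤ detour L ε ω :=
  Finset.sum_nonneg fun _ _ => Real.sqrt_nonneg _

theorem norm_arcPath {R : ℝ} (hR : 0 < R) (x : ℝ) : ‖arcPath R x‖ = R := by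
  rw [arcPath, norm_mul, Complex.norm_exp_ofReal_mul_I, mul_one, Complex.norm_real,
    Real.norm_of_nonneg hR.le]

theorem arcPath_re (R x : ℝ) :
    (arcPath R x).re = R * Real.cos (Real.pi * (3 / 2 - 2 * x)) := by
  rw [arcPath, Complex.re_ofReal_mul, Complex.exp_ofReal_mul_I_re]

theorem arcPath_re_nonneg {R x : ℝ} (hR : 0 < R) (hx : 1 / 2 ≤ x) (hx' : x ≤ 1) :
    0 ≤ (arcPath R x).re := by
  rw [arcPath_re]
  refine mul_nonneg hR.le (Real.cos_nonneg_of_neg_pi_div_two_le_of_le ?_ ?_) <;>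
    nlinarith [Real.pi_pos]

theorem arcPath_half (R : ℝ) : arcPath R (1 / 2) = R * Complex.I := by
  have : Real.pi * (3 / 2 - 2 * (1 / 2)) = Real.pi / 2 := by ring
  rw [arcPath, this]
  simp [Complex.exp_pi_div_two_mul_I]

theorem arcPath_one (R : ℝ) : arcPath R 1 = -(R * Complex.I) := by
  have : Real.pi * (3 / 2 - 2 * 1) = -(Real.pi / 2) := by ring
  rw [arcPath, this]
  push_cast
  rw [neg_mul, Complex.exp_neg, Complex.exp_pi_div_two_mul_I, Complex.inv_I]
  ring

namespace Clear

variable {L : RatFunc ℝ} {S : Finset ℂ} {R ε : ℝ}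

theorem poles_subset (h : Clear L S R ε) : imaginaryPoles L ⊆ S := fun _ hp =>
  h.poles_mem _ (Polynomial.mem_aroots.1 (Multiset.mem_toFinset.1 (Finset.mem_filter.1 hp).1)).2

theorem radius_pos (h : Clear L S R ε) : 0 < R := h.eps_pos.trans h.eps_lt

theorem detour_eq (h : Clear L S R ε) {p : ℂ} (hp : p ∈ imaginaryPoles L) {ω : ℝ}
    (hω : |ω - p.im| ≤ ε) : detour L ε ω = √(ε ^ 2 - (ω - p.im) ^ 2) := by
  refine Finset.sum_eq_single_of_mem p hp fun q hq hqp => Real.sqrt_eq_zero_of_nonpos ?_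
  have hqre : q.re = 0 := (Finset.mem_filter.1 hq).2
  have h1 := h.separated p hp q (h.poles_subset hq) hqre hqp
  have h2 : |q.im - p.im| ≤ |ω - q.im| + |ω - p.im| := by
    have := abs_sub_le q.im ω p.im
    rwa [abs_sub_comm q.im ω] at this
  have h3 : ε ≤ |ω - q.im| := by linarith
  have h4 := pow_le_pow_left₀ h.eps_pos.le h3 2
  rw [sq_abs] at h4
  linarith

theorem detour_eq_zero (h : Clear L S R ε) {ω : ℝ}
    (hω : ∀ p ∈ imaginaryPoles L, ε ≤ |ω - p.im|) : detour L ε ω = 0 := by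
  refine Finset.sum_eq_zero fun p hp => Real.sqrt_eq_zero_of_nonpos ?_
  have h4 := pow_le_pow_left₀ h.eps_pos.le (hω p hp) 2
  rw [sq_abs] at h4
  linarith

theorem detour_le (h : Clear L S R ε) (ω : ℝ) : detour L ε ω ≤ ε := by
  by_cases hω : ∀ p ∈ imaginaryPoles L, ε ≤ |ω - p.im|
  · rw [h.detour_eq_zero hω]
    exact h.eps_pos.le
  · push Not at hω
    obtain ⟨p, hp, hlt⟩ := hω
    rw [h.detour_eq hp hlt.le]
    exact Real.sqrt_le_iff.2 ⟨h.eps_pos.le, by nlinarith⟩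

theorem detour_radius (h : Clear L S R ε) {ω : ℝ} (hω : |ω| = R) : detour L ε ω = 0 := by
  refine h.detour_eq_zero fun p hp => ?_
  have h1 := h.norm_lt p (h.poles_subset hp)
  have h2 := Complex.abs_im_le_norm p
  have h3 := abs_sub_abs_le_abs_sub ω p.im
  linarith

theorem axisPath_radius (h : Clear L S R ε) : axisPath L ε R = R * Complex.I := by
  rw [axisPath, h.detour_radius (abs_of_pos h.radius_pos)]
  simp

theorem axisPath_neg_radius (h : Clear L S R ε) : axisPath L ε (-R) = -(R * Complex.I) := by
  rw [axisPath, h.detour_radius (by rw [abs_neg, abs_of_pos h.radius_pos])]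
  simp

theorem contour_re_nonneg (h : Clear L S R ε) (t : ℝ) : 0 ≤ (nyquistContour L R ε t).re := by
  rcases le_or_gt (Int.fract t) (1 / 2) with ht | ht
  · rw [nyquistContour_of_le ht, axisPath_re]
    exact detour_nonneg _ _ _
  · rw [nyquistContour_of_lt ht]
    exact arcPath_re_nonneg h.radius_pos ht.le (Int.fract_lt_one t).le

theorem continuous_contour (h : Clear L S R ε) : Continuous (nyquistContour L R ε) := by
  have hc : Continuous fun x : ℝ =>
      if x ≤ 1 / 2 then axisPath L ε (R * (4 * x - 1)) else arcPath R x := by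
    refine Continuous.if_le ((continuous_axisPath L ε).comp (by fun_prop)) (continuous_arcPath R)
      continuous_id continuous_const fun x hx => ?_
    have hx : x = 1 / 2 := hx
    subst hx
    rw [arcPath_half, ← h.axisPath_radius]
    congr 1
    ring
  refine hc.continuousOn.comp_fract'' ?_
  rw [if_pos (by norm_num), if_neg (by norm_num), arcPath_one, ← h.axisPath_neg_radius]
  congr 1
  ring

/-- Seen from a point outside its interior, the contour never crosses the branch cut of the
principal argument. -/
theorem isPhase_outer (h : Clear L S R ε) {z : ℂ} (hz : z.re ≤ 0) :
    IsPhase (fun t => nyquistContour L R ε t - z)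
      (fun t => (nyquistContour L R ε t - z).arg) 0 where
  polar t := (Complex.norm_mul_exp_arg_mul_I _).symm
  continuousAt t ht := by
    have hre : 0 ≤ (nyquistContour L R ε t - z).re := by
      rw [Complex.sub_re]
      linarith [h.contour_re_nonneg t]
    have hs : nyquistContour L R ε t - z ∈ Complex.slitPlane := by
      rw [Complex.mem_slitPlane_iff]
      by_contra! hcon
      exact ht (Complex.ext (le_antisymm hcon.1 hre) hcon.2)
    exact (Complex.continuousAt_arg hs).comp (f := fun t => nyquistContour L R ε t - z)
      (h.continuous_contour.sub continuous_const).continuousAt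
  turn t := by
    rw [nyquistContour_add_one]
    simp

theorem one_sub_div_arcPath_re_pos (hR : 0 < R) {z : ℂ} (hz : ‖z‖ < R) (x : ℝ) :
    0 < (1 - z / arcPath R x).re := by
  have h1 : ‖z / arcPath R x‖ < 1 := by
    rw [norm_div, norm_arcPath hR, div_lt_one hR]
    exact hz
  have h2 := (Complex.re_le_norm (z / arcPath R x)).trans_lt h1
  rw [Complex.sub_re, Complex.one_re]
  linarith

theorem arg_I_mul {w : ℂ} (hw : 0 < w.re) : (Complex.I * w).arg = Real.pi / 2 + w.arg := by
  have h0 : w ≠ 0 := fun h => by simp [h] at hw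
  have h1 := abs_lt.1 (Complex.abs_arg_lt_pi_div_two_iff.2 (Or.inl hw))
  rw [Complex.arg_mul Complex.I_ne_zero h0, Complex.arg_I]
  rw [Complex.arg_I]
  constructor <;> linarith [Real.pi_pos]

theorem arg_neg_I_mul {w : ℂ} (hw : 0 < w.re) :
    (-Complex.I * w).arg = -(Real.pi / 2) + w.arg := by
  have h0 : w ≠ 0 := fun h => by simp [h] at hw
  have h1 := abs_lt.1 (Complex.abs_arg_lt_pi_div_two_iff.2 (Or.inl hw))
  rw [Complex.arg_mul (neg_ne_zero.2 Complex.I_ne_zero) h0, Complex.arg_neg_I]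
  rw [Complex.arg_neg_I]
  constructor <;> linarith [Real.pi_pos]

/-- One period of the phase of the contour seen from an enclosed point `z`. On the indented axis
`z - Γ` stays in the right half plane, on the half circle `1 - z / Γ` does; both parts are
therefore expressed by the principal argument. -/
noncomputable def innerPhase (L : RatFunc ℝ) (R ε : ℝ) (z : ℂ) (x : ℝ) : ℝ :=
  if x ≤ 1 / 2 then Real.pi + (z - axisPath L ε (R * (4 * x - 1))).arg
  else Real.pi * (3 / 2 - 2 * x) + (1 - z / arcPath R x).arg

theorem continuous_innerPhase (h : Clear L S R ε) {z : ℂ} (hz : ε < z.re) (hzR : ‖z‖ < R) :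
    Continuous (innerPhase L R ε z) := by
  have hR := h.radius_pos
  refine Continuous.if_le ?_ ?_ continuous_id continuous_const fun x hx => ?_
  · refine continuous_const.add (continuous_iff_continuousAt.2 fun x => ?_)
    refine (Complex.continuousAt_arg (Or.inl ?_)).comp
      (f := fun x : ℝ => z - axisPath L ε (R * (4 * x - 1)))
      (continuous_const.sub ((continuous_axisPath L ε).comp (by fun_prop))).continuousAt
    rw [Complex.sub_re, axisPath_re]
    linarith [h.detour_le (R * (4 * x - 1))]
  · refine Continuous.add (by fun_prop) (continuous_iff_continuousAt.2 fun x => ?_)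
    refine (Complex.continuousAt_arg (Or.inl (one_sub_div_arcPath_re_pos hR hzR x))).comp
      (f := fun x : ℝ => 1 - z / arcPath R x)
      (continuous_const.sub (continuous_const.div (continuous_arcPath R) fun x hx => ?_)).continuousAt
    have := norm_arcPath hR x
    rw [hx, norm_zero] at this
    exact hR.ne this
  · have hx : x = 1 / 2 := hx
    subst hx
    have e1 : R * (4 * (1 / 2) - 1) = R := by ring
    have hRC : (R : ℂ) ≠ 0 := by exact_mod_cast hR.ne'
    have e2 : 1 - z / (R * Complex.I) = ((R⁻¹ : ℝ) : ℂ) * (Complex.I * (z - R * Complex.I)) := by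
      push_cast
      field_simp
      linear_combination (R * Complex.I - z) * Complex.I_sq
    rw [e1, h.axisPath_radius, arcPath_half, e2, Complex.arg_real_mul _ (inv_pos.2 hR),
      arg_I_mul]
    · ring
    · simp
      linarith [h.eps_pos]

theorem innerPhase_zero_sub_one (h : Clear L S R ε) {z : ℂ} (hz : 0 < z.re) :
    innerPhase L R ε z 0 - innerPhase L R ε z 1 = 2 * Real.pi := by
  have hR := h.radius_pos
  have hRC : (R : ℂ) ≠ 0 := by exact_mod_cast hR.ne'
  have e1 : R * (4 * 0 - 1) = -R := by ring
  have e2 : 1 - z / -(R * Complex.I) =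
      ((R⁻¹ : ℝ) : ℂ) * (-Complex.I * (z - -(R * Complex.I))) := by
    push_cast
    field_simp
    linear_combination (R * Complex.I + z) * Complex.I_sq
  rw [innerPhase, innerPhase, if_pos (by norm_num), if_neg (by norm_num), e1,
    h.axisPath_neg_radius, arcPath_one, e2, Complex.arg_real_mul _ (inv_pos.2 hR),
    arg_neg_I_mul]
  · ring
  · simpa using hz

/-- The contour turns once, clockwise, around each point that it encloses. -/
theorem exists_isPhase_inner (h : Clear L S R ε) {z : ℂ} (hz : ε < z.re) (hzR : ‖z‖ < R) :
    ∃ θ, IsPhase (fun t => nyquistContour L R ε t - z) θ 1 := by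
  have hR := h.radius_pos
  have hz0 : 0 < z.re := h.eps_pos.trans hz
  have hcont : Continuous fun t : ℝ =>
      innerPhase L R ε z (Int.fract t) + 2 * Real.pi * Int.fract t := by
    have hc : Continuous fun x : ℝ => innerPhase L R ε z x + 2 * Real.pi * x :=
      (h.continuous_innerPhase hz hzR).add (by fun_prop)
    refine hc.continuousOn.comp_fract'' ?_
    linarith [h.innerPhase_zero_sub_one hz0]
  refine ⟨fun t => innerPhase L R ε z (Int.fract t) + 2 * Real.pi * Int.fract t
    - 2 * Real.pi * t, fun t => ?_, fun t _ => ?_, fun t => ?_⟩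
  · -- the correction `2 π (fract t - t)` is an integer multiple of `2 π`
    have e : innerPhase L R ε z (Int.fract t) + 2 * Real.pi * Int.fract t - 2 * Real.pi * t
        = innerPhase L R ε z (Int.fract t) - ((⌊t⌋ : ℤ) : ℝ) * (2 * Real.pi) := by
      rw [Int.fract]
      ring
    rw [e]
    have e' : Complex.exp (((innerPhase L R ε z (Int.fract t)
        - ((⌊t⌋ : ℤ) : ℝ) * (2 * Real.pi) : ℝ) : ℂ) * Complex.I) =
        Complex.exp ((innerPhase L R ε z (Int.fract t) : ℂ) * Complex.I) := by
      rw [Complex.exp_eq_exp_iff_exists_int]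
      refine ⟨-⌊t⌋, ?_⟩
      push_cast
      ring
    rw [e']
    rcases le_or_gt (Int.fract t) (1 / 2) with ht | ht
    · rw [nyquistContour_of_le ht, innerPhase, if_pos ht]
      push_cast
      rw [add_mul, Complex.exp_add, Complex.exp_pi_mul_I, ← norm_neg, neg_sub]
      linear_combination (-1 : ℂ) * (Complex.norm_mul_exp_arg_mul_I
        (z - axisPath L ε (R * (4 * Int.fract t - 1)))).symm
    · have hne : arcPath R (Int.fract t) ≠ 0 := by
        rw [← norm_pos_iff, norm_arcPath hR]
        exact hR
      rw [nyquistContour_of_lt ht, innerPhase, if_neg ht.not_ge, Complex.ofReal_add, add_mul,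
        Complex.exp_add]
      have hf : arcPath R (Int.fract t) - z
          = arcPath R (Int.fract t) * (1 - z / arcPath R (Int.fract t)) := by
        field_simp
      rw [hf, norm_mul, norm_arcPath hR, Complex.ofReal_mul]
      conv_lhs => rw [← Complex.norm_mul_exp_arg_mul_I (1 - z / arcPath R (Int.fract t))]
      conv_lhs => enter [1]; rw [arcPath]
      ring
  · exact (hcont.sub (by fun_prop)).continuousAt
  · simp only [Int.fract_add_one]
    push_cast
    ring

theorem exists_isPhase_sub (h : Clear L S R ε) {z : ℂ} (hz : z ∈ S) :
    ∃ θ, IsPhase (fun t => nyquistContour L R ε t - z) θ (if 0 < z.re then 1 else 0) := by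
  split_ifs with hre
  · exact h.exists_isPhase_inner (h.lt_re z hz hre) (by linarith [h.norm_lt z hz, h.eps_pos])
  · exact ⟨_, h.isPhase_outer (not_lt.1 hre)⟩

/-- Every point of `S` on the imaginary axis, other than the poles, lies on the contour. -/
theorem exists_contour_eq (h : Clear L S R ε) {z : ℂ} (hz : z ∈ S) (hre : z.re = 0)
    (hz' : z ∉ imaginaryPoles L) : ∃ t, nyquistContour L R ε t = z := by
  have hR := h.radius_pos
  have him : |z.im| < R := by linarith [h.norm_lt z hz, h.eps_pos, Complex.abs_im_le_norm z]
  obtain ⟨h1, h2⟩ := abs_lt.1 him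
  have hq : |z.im / R| < 1 := by
    rw [abs_div, abs_of_pos hR, div_lt_one hR]
    exact him
  obtain ⟨h3, h4⟩ := abs_lt.1 hq
  have hf : Int.fract ((z.im / R + 1) / 4) = (z.im / R + 1) / 4 :=
    Int.fract_eq_self.2 ⟨by linarith, by linarith⟩
  refine ⟨(z.im / R + 1) / 4, ?_⟩
  rw [nyquistContour_of_le (by rw [hf]; linarith), hf]
  have e : R * (4 * ((z.im / R + 1) / 4) - 1) = z.im := by
    field_simp
    ring
  rw [e]
  refine Complex.ext ?_ (axisPath_im _ _ _)
  rw [axisPath_re, hre]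
  refine h.detour_eq_zero fun p hp => ?_
  have := h.separated p hp z hz hre fun hzp => hz' (hzp ▸ hp)
  linarith [h.eps_pos]

end Clear

/-! ### One-sided signs along analytic arcs -/

/-- The function `h` has a definite sign (positive, negative or zero) along the filter `l`. -/
def HasSign (h : ℝ → ℝ) (l : Filter ℝ) : Prop :=
  (∀ᶠ u in l, 0 < h u) ∨ (∀ᶠ u in l, h u < 0) ∨ (∀ᶠ u in l, h u = 0)

/-- `l` is the filter of right or of left neighbourhoods of `x`. -/
def IsSide (l : Filter ℝ) (x : ℝ) : Prop := l = 𝓝[>] x ∨ l = 𝓝[<] x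

theorem IsSide.neBot {l : Filter ℝ} {x : ℝ} (h : IsSide l x) : l.NeBot := by
  rcases h with rfl | rfl <;> infer_instance

theorem IsSide.le_nhds {l : Filter ℝ} {x : ℝ} (h : IsSide l x) : l ≤ 𝓝 x := by
  rcases h with rfl | rfl <;> exact nhdsWithin_le_nhds

theorem HasSign.comp {h τ : ℝ → ℝ} {l l' : Filter ℝ} (hs : HasSign h l') (hτ : Tendsto τ l l') :
    HasSign (fun u => h (τ u)) l :=
  hs.imp (fun H => hτ.eventually H) (Or.imp (fun H => hτ.eventually H) fun H => hτ.eventually H)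

theorem HasSign.congr {h k : ℝ → ℝ} {l : Filter ℝ} (hs : HasSign h l) (hk : ∀ᶠ u in l, k u = h u) :
    HasSign k l := by
  refine hs.imp (fun H => ?_) (Or.imp (fun H => ?_) fun H => ?_) <;>
    filter_upwards [H, hk] with u h1 h2 <;> rw [h2] <;> exact h1

theorem hasSign_nhdsGT_of_analyticAt {k : ℝ → ℝ} {x : ℝ} (hk : AnalyticAt ℝ k x) :
    HasSign k (𝓝[>] x) := by
  by_cases h0 : ∀ᶠ z in 𝓝 x, k z = 0
  · exact Or.inr (Or.inr (h0.filter_mono nhdsWithin_le_nhds))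
  · obtain ⟨n, g, hg, hgx, hkg⟩ := hk.exists_eventuallyEq_pow_smul_nonzero_iff.2 h0
    have hc := hg.continuousAt
    rcases lt_or_gt_of_ne hgx with hneg | hpos
    · right; left
      filter_upwards [hkg.filter_mono nhdsWithin_le_nhds,
        (hc.eventually_lt_const hneg).filter_mono nhdsWithin_le_nhds, self_mem_nhdsWithin]
        with u h1 h2 h3
      rw [h1, smul_eq_mul]
      exact mul_neg_of_pos_of_neg (pow_pos (sub_pos.2 h3) n) h2
    · left
      filter_upwards [hkg.filter_mono nhdsWithin_le_nhds,
        (hc.eventually_const_lt hpos).filter_mono nhdsWithin_le_nhds, self_mem_nhdsWithin]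
        with u h1 h2 h3
      rw [h1, smul_eq_mul]
      exact mul_pos (pow_pos (sub_pos.2 h3) n) h2

theorem hasSign_of_analyticAt {k : ℝ → ℝ} {x : ℝ} (hk : AnalyticAt ℝ k x) {l : Filter ℝ}
    (hl : IsSide l x) : HasSign k l := by
  rcases hl with rfl | rfl
  · exact hasSign_nhdsGT_of_analyticAt hk
  · have hk' : AnalyticAt ℝ (fun u => k (-u)) (-x) :=
      AnalyticAt.fun_comp (by rwa [neg_neg]) analyticAt_id.neg
    have := (hasSign_nhdsGT_of_analyticAt hk').comp (tendsto_neg_nhdsLT (a := x))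
    simpa only [neg_neg] using this

theorem analyticAt_ofReal {τ : ℝ → ℝ} {x : ℝ} (hτ : AnalyticAt ℝ τ x) :
    AnalyticAt ℝ (fun u => (τ u : ℂ)) x :=
  (Complex.ofRealCLM.analyticAt _).comp hτ

theorem analyticAt_circle {τ : ℝ → ℝ} {x : ℝ} (c r : ℂ) (hτ : AnalyticAt ℝ τ x) :
    AnalyticAt ℝ (fun u => c + r * Complex.exp ((τ u : ℂ) * Complex.I)) x := by
  have h1 : AnalyticAt ℝ Complex.exp ((τ x : ℂ) * Complex.I) :=
    analyticAt_cexp.restrictScalars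
  exact analyticAt_const.add (analyticAt_const.mul
    (AnalyticAt.fun_comp h1 ((analyticAt_ofReal hτ).mul analyticAt_const)))

/-- The imaginary part of `L` along a curve has one-sided signs if the curve is, on that side, a
monotone reparametrization of an analytic curve that ends at a regular point of `L`. -/
theorem hasSign_eval_im (L : RatFunc ℝ) {Γ γ : ℝ → ℂ} {τ : ℝ → ℝ} {l l' : Filter ℝ} {x : ℝ}
    (hγ : AnalyticAt ℝ γ x) (hD : Polynomial.aeval (γ x) L.denom ≠ 0) (hl : IsSide l' x)
    (hτ : Tendsto τ l l') (hΓ : ∀ᶠ u in l, Γ u = γ (τ u)) :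
    HasSign (fun u => (RatFunc.eval (algebraMap ℝ ℂ) (Γ u) L).im) l := by
  have h1 : AnalyticAt ℝ
      (fun y => Polynomial.aeval (γ y) L.num / Polynomial.aeval (γ y) L.denom) x :=
    (hγ.aeval_polynomial L.num).div (hγ.aeval_polynomial L.denom) hD
  have h2 : AnalyticAt ℝ
      (fun y => (Polynomial.aeval (γ y) L.num / Polynomial.aeval (γ y) L.denom).im) x :=
    (Complex.imCLM.analyticAt _).comp h1
  refine ((hasSign_of_analyticAt h2 hl).comp hτ).congr ?_
  filter_upwards [hΓ] with u hu
  rw [hu]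
  rfl

/-- Strictly monotone reparametrization preserves the side. -/
theorem exists_isSide_tendsto {τ : ℝ → ℝ} {s : Set ℝ} (hτ : StrictMonoOn τ s) {l : Filter ℝ}
    {x : ℝ} (hl : IsSide l x) (hc : ContinuousAt τ x) (hx : x ∈ s) (hs : ∀ᶠ u in l, u ∈ s) :
    ∃ l', IsSide l' (τ x) ∧ Tendsto τ l l' := by
  rcases hl with rfl | rfl
  · refine ⟨_, Or.inl rfl, tendsto_nhdsWithin_iff.2 ⟨hc.mono_left nhdsWithin_le_nhds, ?_⟩⟩
    filter_upwards [hs, self_mem_nhdsWithin] with u hu hxu using hτ hx hu hxu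
  · refine ⟨_, Or.inr rfl, tendsto_nhdsWithin_iff.2 ⟨hc.mono_left nhdsWithin_le_nhds, ?_⟩⟩
    filter_upwards [hs, self_mem_nhdsWithin] with u hu hxu using hτ hu hx hxu

namespace Clear

variable {L : RatFunc ℝ} {S : Finset ℂ} {R ε : ℝ}

theorem axisPath_eq_indentation (h : Clear L S R ε) {p : ℂ} (hp : p ∈ imaginaryPoles L) {ω : ℝ}
    (hω : |ω - p.im| ≤ ε) :
    axisPath L ε ω = (p.im : ℂ) * Complex.I +
      (ε : ℂ) * Complex.exp ((Real.arcsin ((ω - p.im) / ε) : ℂ) * Complex.I) := by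
  have hε := h.eps_pos
  obtain ⟨h1, h2⟩ := abs_le.1 hω
  have h3 : -1 ≤ (ω - p.im) / ε := by rw [le_div_iff₀ hε]; linarith
  have h4 : (ω - p.im) / ε ≤ 1 := by rw [div_le_iff₀ hε]; linarith
  apply Complex.ext
  · rw [axisPath_re, h.detour_eq hp hω, Complex.add_re, Complex.re_ofReal_mul,
      Complex.re_ofReal_mul, Complex.exp_ofReal_mul_I_re, Real.cos_arcsin, Complex.I_re, mul_zero,
      zero_add]
    have e : ε ^ 2 - (ω - p.im) ^ 2 = ε ^ 2 * (1 - ((ω - p.im) / ε) ^ 2) := by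
      field_simp
    rw [e, Real.sqrt_mul (sq_nonneg ε), Real.sqrt_sq hε.le]
  · rw [axisPath_im, Complex.add_im, Complex.im_ofReal_mul, Complex.im_ofReal_mul,
      Complex.exp_ofReal_mul_I_im, Real.sin_arcsin h3 h4, Complex.I_im]
    field_simp
    ring

theorem axisPath_ne (h : Clear L S R ε) {z : ℂ} (hz : z ∈ S)
    (hz' : z.re = 0 → z ∈ imaginaryPoles L) (ω : ℝ) : axisPath L ε ω ≠ z := by
  intro heq
  have hre := congrArg Complex.re heq
  have him := congrArg Complex.im heq
  rw [axisPath_re] at hre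
  rw [axisPath_im] at him
  rcases lt_trichotomy z.re 0 with h0 | h0 | h0
  · linarith [detour_nonneg L ε ω]
  · rw [h.detour_eq (hz' h0) (by rw [him, sub_self, abs_zero]; exact h.eps_pos.le), him, h0,
      sub_self] at hre
    rw [show ε ^ 2 - 0 ^ 2 = ε ^ 2 by ring, Real.sqrt_sq h.eps_pos.le] at hre
    exact h.eps_pos.ne' hre
  · linarith [h.detour_le ω, h.lt_re z hz h0]

theorem arcPath_ne (h : Clear L S R ε) {z : ℂ} (hz : z ∈ S) (x : ℝ) : arcPath R x ≠ z := by
  intro heq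
  have := norm_arcPath h.radius_pos x
  rw [heq] at this
  linarith [h.norm_lt z hz, h.eps_pos]

theorem mem_imaginaryPoles {z : ℂ} (hz : Polynomial.aeval z L.denom = 0) (hre : z.re = 0) :
    z ∈ imaginaryPoles L := by
  refine Finset.mem_filter.2 ⟨?_, hre⟩
  rw [Multiset.mem_toFinset, Polynomial.mem_aroots]
  exact ⟨L.denom_ne_zero, hz⟩

theorem denom_axisPath_ne (h : Clear L S R ε) (ω : ℝ) :
    Polynomial.aeval (axisPath L ε ω) L.denom ≠ 0 := fun h0 =>
  h.axisPath_ne (h.poles_mem _ h0) (fun hre => mem_imaginaryPoles h0 hre) ω rfl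

theorem denom_arcPath_ne (h : Clear L S R ε) (x : ℝ) :
    Polynomial.aeval (arcPath R x) L.denom ≠ 0 := fun h0 => h.arcPath_ne (h.poles_mem _ h0) x rfl

theorem denom_contour_ne (h : Clear L S R ε) (t : ℝ) :
    Polynomial.aeval (nyquistContour L R ε t) L.denom ≠ 0 := by
  rcases le_or_gt (Int.fract t) (1 / 2) with ht | ht
  · rw [nyquistContour_of_le ht]
    exact h.denom_axisPath_ne _
  · rw [nyquistContour_of_lt ht]
    exact h.denom_arcPath_ne _

theorem hasSign_axisPath (h : Clear L S R ε) {l : Filter ℝ} {ω₀ : ℝ} (hl : IsSide l ω₀) :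
    HasSign (fun ω => (RatFunc.eval (algebraMap ℝ ℂ) (axisPath L ε ω) L).im) l := by
  have hε := h.eps_pos
  have := hl.neBot
  -- on one side of `ω₀` the path is either on a single indentation or off all of them
  have hdich : ∀ p : ℂ, (∀ᶠ ω in l, |ω - p.im| ≤ ε) ∨ (∀ᶠ ω in l, ε ≤ |ω - p.im|) := by
    intro p
    have ha : AnalyticAt ℝ (fun ω : ℝ => ε ^ 2 - (ω - p.im) ^ 2) ω₀ := by fun_prop
    rcases hasSign_of_analyticAt ha hl with H | H | H
    · left
      filter_upwards [H] with ω hω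
      exact abs_le_of_sq_le_sq (by linarith) hε.le
    · right
      filter_upwards [H] with ω hω
      rw [← abs_of_pos hε]
      exact sq_le_sq.1 (by linarith)
    · left
      filter_upwards [H] with ω hω
      exact abs_le_of_sq_le_sq (by linarith) hε.le
  have hlim : ∀ p : ℂ, Tendsto (fun ω : ℝ => |ω - p.im|) l (𝓝 |ω₀ - p.im|) := fun p =>
    (Continuous.tendsto (by fun_prop) ω₀).mono_left hl.le_nhds
  by_cases hex : ∃ p ∈ imaginaryPoles L, ∀ᶠ ω in l, |ω - p.im| ≤ ε
  · obtain ⟨p, hp, hev⟩ := hex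
    have h0 : |ω₀ - p.im| ≤ ε := le_of_tendsto (hlim p) hev
    have hmono : StrictMonoOn (fun ω : ℝ => Real.arcsin ((ω - p.im) / ε))
        {ω | |ω - p.im| ≤ ε} := by
      intro a (ha : |a - p.im| ≤ ε) b (hb : |b - p.im| ≤ ε) hab
      obtain ⟨a1, a2⟩ := abs_le.1 ha
      obtain ⟨b1, b2⟩ := abs_le.1 hb
      refine Real.strictMonoOn_arcsin ⟨?_, ?_⟩ ⟨?_, ?_⟩ ?_
      · rw [le_div_iff₀ hε]; linarith
      · rw [div_le_iff₀ hε]; linarith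
      · rw [le_div_iff₀ hε]; linarith
      · rw [div_le_iff₀ hε]; linarith
      · exact div_lt_div_of_pos_right (by linarith) hε
    have hcont : Continuous fun ω : ℝ => Real.arcsin ((ω - p.im) / ε) :=
      Real.continuous_arcsin.comp (by fun_prop)
    obtain ⟨l', hl', hτ⟩ := exists_isSide_tendsto hmono hl hcont.continuousAt h0 hev
    refine hasSign_eval_im L (γ := fun θ : ℝ => (p.im : ℂ) * Complex.I +
      (ε : ℂ) * Complex.exp ((θ : ℂ) * Complex.I)) (analyticAt_circle _ _ analyticAt_id) ?_ hl' hτ ?_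
    · have := h.denom_axisPath_ne ω₀
      rwa [h.axisPath_eq_indentation hp h0] at this
    · filter_upwards [hev] with ω hω using h.axisPath_eq_indentation hp hω
  · have hev : ∀ p ∈ imaginaryPoles L, ∀ᶠ ω in l, ε ≤ |ω - p.im| := fun p hp =>
      (hdich p).resolve_left fun H => hex ⟨p, hp, H⟩
    have h0 : axisPath L ε ω₀ = (ω₀ : ℂ) * Complex.I := by
      rw [axisPath, h.detour_eq_zero fun p hp => ge_of_tendsto (hlim p) (hev p hp)]
      simp
    refine hasSign_eval_im L (γ := fun ω : ℝ => (ω : ℂ) * Complex.I) (τ := id)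
      ((analyticAt_ofReal analyticAt_id).mul analyticAt_const) ?_ hl
      tendsto_id ?_
    · have := h.denom_axisPath_ne ω₀
      rwa [h0] at this
    · filter_upwards [(Filter.eventually_all_finset _).2 hev] with ω hω
      rw [axisPath, h.detour_eq_zero hω]
      simp

theorem hasSign_nyquistPlot (h : Clear L S R ε) {l : Filter ℝ} {t : ℝ} (hl : IsSide l t) :
    HasSign (fun u => (nyquistPlot L R ε u).im) l := by
  have hR := h.radius_pos
  have hfract : ∃ n : ℤ, ∀ᶠ u in l, Int.fract u = u - (n : ℝ) := by
    rcases hl with rfl | rfl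
    · refine ⟨⌊t⌋, ?_⟩
      filter_upwards [Ioo_mem_nhdsGT (Int.lt_floor_add_one t)] with u hu
      rw [Int.fract, Int.floor_eq_iff.2 ⟨(Int.floor_le t).trans hu.1.le, hu.2⟩]
    · refine ⟨⌈t⌉ - 1, ?_⟩
      have h1 : (((⌈t⌉ - 1 : ℤ)) : ℝ) < t := by
        push_cast
        linarith [Int.ceil_lt_add_one t]
      filter_upwards [Ioo_mem_nhdsLT h1] with u hu
      rw [Int.fract, Int.floor_eq_iff.2 ⟨hu.1.le, ?_⟩]
      push_cast
      linarith [hu.2, Int.le_ceil t]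
  obtain ⟨n, hn⟩ := hfract
  have ha : AnalyticAt ℝ (fun u : ℝ => u - n - 1 / 2) t := by fun_prop
  have hhalf : (∀ᶠ u in l, u - (n : ℝ) ≤ 1 / 2) ∨ (∀ᶠ u in l, 1 / 2 < u - (n : ℝ)) := by
    rcases hasSign_of_analyticAt ha hl with H | H | H
    · right
      filter_upwards [H] with u hu
      linarith
    · left
      filter_upwards [H] with u hu
      linarith
    · left
      filter_upwards [H] with u hu
      linarith
  rcases hhalf with H | H
  · have hmono : StrictMonoOn (fun u : ℝ => R * (4 * (u - n) - 1)) Set.univ := by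
      intro a _ b _ hab
      have : 4 * (a - n) - 1 < 4 * (b - n) - 1 := by linarith
      exact mul_lt_mul_of_pos_left this hR
    obtain ⟨l', hl', hτ⟩ := exists_isSide_tendsto hmono hl
      (Continuous.continuousAt (by fun_prop)) (Set.mem_univ t) (Eventually.of_forall Set.mem_univ)
    refine ((h.hasSign_axisPath hl').comp hτ).congr ?_
    filter_upwards [hn, H] with u hu hu'
    rw [nyquistPlot, nyquistContour_of_le (hu.trans_le hu'), hu]
  · have hmono : StrictMonoOn (fun u : ℝ => u - n) Set.univ := fun a _ b _ hab => by
      simpa using hab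
    obtain ⟨l', hl', hτ⟩ := exists_isSide_tendsto hmono hl
      (Continuous.continuousAt (by fun_prop)) (Set.mem_univ t) (Eventually.of_forall Set.mem_univ)
    refine hasSign_eval_im L (γ := arcPath R) ?_ (h.denom_arcPath_ne _) hl' hτ ?_
    · simpa only [zero_add] using! analyticAt_circle (x := t - n) 0 R
        (τ := fun x => Real.pi * (3 / 2 - 2 * x)) (by fun_prop)
    · filter_upwards [hn, H] with u hu hu'
      rw [nyquistContour_of_lt (hu'.trans_eq hu.symm), hu]

theorem continuous_nyquistPlot (h : Clear L S R ε) : Continuous (nyquistPlot L R ε) :=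
  ((Polynomial.continuous_aeval L.num).comp h.continuous_contour).div
    ((Polynomial.continuous_aeval L.denom).comp h.continuous_contour) h.denom_contour_ne

end Clear

/-! ### Crossings of the critical rays -/

/-- Near a point of the negative real axis, the phase lies above or below its value there according
to the sign of the imaginary part. -/
theorem eventually_im_sign_iff {g : ℝ → ℂ} {α : ℝ → ℝ} {t : ℝ} {k : ℤ}
    (hg : ∀ u, g u = (‖g u‖ : ℂ) * Complex.exp ((α u : ℂ) * Complex.I))
    (hgt : g t ≠ 0) (hgc : ContinuousAt g t) (hα : ContinuousAt α t)
    (hk : α t = -Real.pi + 2 * Real.pi * k) :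
    ∀ᶠ u in 𝓝 t, (0 < (g u).im ↔ α u < α t) ∧ ((g u).im < 0 ↔ α t < α u) := by
  have h1 : ∀ᶠ u in 𝓝 t, α t - Real.pi < α u :=
    hα.eventually_const_lt (by linarith [Real.pi_pos])
  have h2 : ∀ᶠ u in 𝓝 t, α u < α t + Real.pi :=
    hα.eventually_lt_const (by linarith [Real.pi_pos])
  filter_upwards [h1, h2, hgc.eventually_ne hgt] with u h1 h2 h3
  have hpos : 0 < ‖g u‖ := norm_pos_iff.2 h3
  have him : (g u).im = ‖g u‖ * Real.sin (α t - α u) := by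
    have e : Real.sin (α u) = Real.sin (α t - α u) := by
      have : α t - α u = -Real.pi - α u + k * (2 * Real.pi) := by rw [hk]; ring
      rw [this, Real.sin_add_int_mul_two_pi, ← neg_add', Real.sin_neg, add_comm, Real.sin_add_pi,
        neg_neg]
    have := congrArg Complex.im (hg u)
    rwa [Complex.im_ofReal_mul, Complex.exp_ofReal_mul_I_im, e] at this
  rw [him, mul_pos_iff_of_pos_left hpos, mul_neg_iff]
  rcases lt_trichotomy (α u) (α t) with h | h | h
  · have := Real.sin_pos_of_pos_of_lt_pi (x := α t - α u) (by linarith) (by linarith)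
    exact ⟨iff_of_true this h, iff_of_false (by rintro (h | h) <;> linarith) (by linarith)⟩
  · simp [h]
  · have := Real.sin_neg_of_neg_of_neg_pi_lt (x := α t - α u) (by linarith) (by linarith)
    exact ⟨iff_of_false (by linarith) (by linarith), iff_of_true (Or.inl ⟨hpos, this⟩) h⟩

theorem re_neg_iff_phase {z : ℂ} {α : ℝ} (hz : z ≠ 0)
    (h : z = (‖z‖ : ℂ) * Complex.exp ((α : ℂ) * Complex.I)) :
    (z.im = 0 ∧ z.re < 0) ↔ ∃ k : ℤ, α = -Real.pi + 2 * Real.pi * k := by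
  have hpos : 0 < ‖z‖ := norm_pos_iff.2 hz
  have hre : z.re = ‖z‖ * Real.cos α := by
    have := congrArg Complex.re h
    rwa [Complex.re_ofReal_mul, Complex.exp_ofReal_mul_I_re] at this
  have him : z.im = ‖z‖ * Real.sin α := by
    have := congrArg Complex.im h
    rwa [Complex.im_ofReal_mul, Complex.exp_ofReal_mul_I_im] at this
  constructor
  · rintro ⟨h1, h2⟩
    rw [him, mul_eq_zero, or_iff_right hpos.ne'] at h1
    rw [hre, mul_neg_iff] at h2
    have hcos : Real.cos α < 0 := by
      rcases h2 with h2 | h2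
      · exact h2.2
      · linarith [h2.1]
    have hc : Real.cos (α + Real.pi) = 1 := by
      rw [Real.cos_add_pi]
      nlinarith [Real.sin_sq_add_cos_sq α]
    obtain ⟨k, hk⟩ := (Real.cos_eq_one_iff _).1 hc
    exact ⟨k, by linarith⟩
  · rintro ⟨k, rfl⟩
    rw [him, hre]
    have e : -Real.pi + 2 * Real.pi * k = -Real.pi + k * (2 * Real.pi) := by ring
    rw [e, Real.sin_add_int_mul_two_pi, Real.cos_add_int_mul_two_pi]
    simpa using hz

theorem decibel_pos_iff {z : ℂ} (hz : z ≠ 0) : 0 < decibel z ↔ 1 < ‖z‖ := by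
  rw [decibel, mul_pos_iff_of_pos_left (by norm_num),
    Real.logb_pos_iff (by norm_num) (norm_pos_iff.2 hz)]

theorem decibel_eq_zero_iff {z : ℂ} (hz : z ≠ 0) : decibel z = 0 ↔ ‖z‖ = 1 := by
  have := norm_pos_iff.2 hz
  rw [decibel, mul_eq_zero, or_iff_right (by norm_num), Real.logb_eq_zero]
  constructor
  · rintro (h | h | h | h | h | h)
    · norm_num at h
    · norm_num at h
    · norm_num at h
    · exact absurd (norm_eq_zero.1 h) hz
    · exact h
    · linarith
  · exact fun h => by simp [h]

theorem norm_of_im_eq_zero {z : ℂ} (h : z.im = 0) : ‖z‖ = |z.re| := by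
  exact (Complex.abs_re_eq_norm.2 h).symm

namespace IsUnwrappedPhase

variable {f : ℝ → ℂ} {φ : ℝ → ℝ}

theorem degree_iff (hφ : IsUnwrappedPhase f φ) {t : ℝ} (ht : f t ≠ 0) :
    (∃ k : ℤ, φ t = -180 + 360 * k) ↔ (f t).im = 0 ∧ (f t).re < 0 := by
  rw [re_neg_iff_phase ht (hφ.phase t ht)]
  refine exists_congr fun k => ?_
  have hpi := Real.pi_pos
  constructor
  · intro h
    rw [h]
    ring
  · intro h
    field_simp at h
    linarith

theorem onRay_iff (hφ : IsUnwrappedPhase f φ) (t : ℝ) :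
    OnRay f φ t ↔ (f t).im = 0 ∧ (f t).re < -1 := by
  constructor
  · rintro ⟨h0, h1, h2⟩
    obtain ⟨h3, h4⟩ := (hφ.degree_iff h0).1 h2
    rw [decibel_pos_iff h0, norm_of_im_eq_zero h3, abs_of_neg h4] at h1
    exact ⟨h3, by linarith⟩
  · rintro ⟨h3, h4⟩
    have h0 : f t ≠ 0 := fun h => by
      rw [h, Complex.zero_re] at h4
      linarith
    refine ⟨h0, ?_, (hφ.degree_iff h0).2 ⟨h3, by linarith⟩⟩
    rw [decibel_pos_iff h0, norm_of_im_eq_zero h3, abs_of_neg (by linarith)]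
    linarith

theorem meetsCriticalPoint_iff (hφ : IsUnwrappedPhase f φ) :
    MeetsCriticalPoint f φ ↔ ∃ t, f t = -1 := by
  refine exists_congr fun t => ?_
  constructor
  · rintro ⟨h0, h1, h2⟩
    obtain ⟨h3, h4⟩ := (hφ.degree_iff h0).1 h2
    rw [decibel_eq_zero_iff h0, norm_of_im_eq_zero h3, abs_of_neg h4] at h1
    refine Complex.ext ?_ ?_
    · simp
      linarith
    · simpa using h3
  · intro h
    have h0 : f t ≠ 0 := by simp [h]
    exact ⟨h0, (decibel_eq_zero_iff h0).2 (by simp [h]), (hφ.degree_iff h0).2 (by simp [h])⟩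

/-- The side on which the Nichols plot leaves a critical ray is read off from the sign of the
imaginary part of the Nyquist plot. -/
theorem side_eq (hφ : IsUnwrappedPhase f φ) (hf : Continuous f) {t : ℝ} (ht : OnRay f φ t)
    {l : Filter ℝ} (hl : IsSide l t) :
    ((∀ᶠ u in l, 0 < (f u).im) → side φ l t = -1) ∧
    ((∀ᶠ u in l, (f u).im < 0) → side φ l t = 1) ∧
    ((∀ᶠ u in l, (f u).im = 0) → side φ l t = 0) := by
  have := hl.neBot
  have hpi := Real.pi_pos
  obtain ⟨h0, -, k, hk⟩ := ht
  have hev := eventually_im_sign_iff (g := f) (α := fun u => φ u * Real.pi / 180) (t := t) (k := k)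
    (fun u => by
      by_cases hu : f u = 0
      · simp [hu]
      · exact hφ.phase u hu)
    h0 hf.continuousAt (((hφ.continuousAt t h0).mul_const _).div_const _)
    (by simp only [hk]; ring)
  have hev : ∀ᶠ u in l, (0 < (f u).im ↔ φ u < φ t) ∧ ((f u).im < 0 ↔ φ t < φ u) := by
    filter_upwards [hev.filter_mono hl.le_nhds] with u hu
    have key : ∀ a b : ℝ, a * Real.pi / 180 < b * Real.pi / 180 ↔ a < b := fun a b => by
      rw [div_lt_div_iff_of_pos_right (by norm_num), mul_lt_mul_iff_left₀ hpi]
    simpa only [key] using hu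
  refine ⟨fun H => ?_, fun H => ?_, fun H => ?_⟩
  · have hlt : ∀ᶠ u in l, φ u < φ t := by
      filter_upwards [H, hev] with u h1 h2 using h2.1.1 h1
    rw [side, if_neg, if_pos hlt]
    intro hgt
    obtain ⟨u, h1, h2⟩ := (hlt.and hgt).exists
    exact lt_asymm h1 h2
  · have hgt : ∀ᶠ u in l, φ t < φ u := by
      filter_upwards [H, hev] with u h1 h2 using h2.2.1 h1
    rw [side, if_pos hgt]
  · have heq : ∀ᶠ u in l, ¬ φ u < φ t ∧ ¬ φ t < φ u := by
      filter_upwards [H, hev] with u h1 h2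
      rw [← h2.1, ← h2.2, h1]
      simp
    rw [side, if_neg, if_neg]
    · intro hlt
      obtain ⟨u, h1, h2⟩ := (hlt.and heq).exists
      exact h2.1 h1
    · intro hgt
      obtain ⟨u, h1, h2⟩ := (hgt.and heq).exists
      exact h2.2 h1

/-- Crossings vanish near, but not necessarily at, each point: off the real axis there are none,
and while the plot runs along a ray both sides are `0`. -/
theorem eventually_crossing_eq_zero (hφ : IsUnwrappedPhase f φ) (hf : Continuous f) {t : ℝ}
    {l : Filter ℝ} (hl : IsSide l t) (hs : HasSign (fun u => (f u).im) l) :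
    ∀ᶠ u in l, crossing f φ u = 0 := by
  have hoff : ∀ u, (f u).im ≠ 0 → crossing f φ u = 0 := fun u hu =>
    if_neg fun h => hu ((hφ.onRay_iff u).1 h).1
  rcases hs with H | H | H
  · filter_upwards [H] with u hu using hoff u hu.ne'
  · filter_upwards [H] with u hu using hoff u hu.ne
  · have H2 : ∀ᶠ u in l, ∀ᶠ w in 𝓝 u, (f w).im = 0 := by
      rcases hl with rfl | rfl
      · filter_upwards [eventually_eventually_nhdsWithin.2 H, self_mem_nhdsWithin] with u hu hu'
        rwa [isOpen_Ioi.nhdsWithin_eq hu'] at hu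
      · filter_upwards [eventually_eventually_nhdsWithin.2 H, self_mem_nhdsWithin] with u hu hu'
        rwa [isOpen_Iio.nhdsWithin_eq hu'] at hu
    filter_upwards [H2] with u hu
    by_cases hr : OnRay f φ u
    · rw [crossing, if_pos hr,
        (hφ.side_eq hf hr (Or.inl rfl)).2.2 (hu.filter_mono nhdsWithin_le_nhds),
        (hφ.side_eq hf hr (Or.inr rfl)).2.2 (hu.filter_mono nhdsWithin_le_nhds)]
      simp
    · exact if_neg hr

theorem finite_crossing (hφ : IsUnwrappedPhase f φ) (hf : Continuous f)
    (hs : ∀ t l, IsSide l t → HasSign (fun u => (f u).im) l) :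
    {t ∈ Set.Ico (0 : ℝ) 1 | crossing f φ t ≠ 0}.Finite := by
  have key : (Set.Icc (0 : ℝ) 1 ∩ {t | crossing f φ t ≠ 0}).Finite := by
    refine isCompact_Icc.induction_on (p := fun s => (s ∩ {t | crossing f φ t ≠ 0}).Finite)
      ?_ ?_ ?_ ?_
    · simp
    · exact fun s t hst ht => ht.subset (Set.inter_subset_inter_left _ hst)
    · intro s t hs ht
      rw [Set.union_inter_distrib_right]
      exact hs.union ht
    · intro t _
      have h1 : ∀ᶠ u in 𝓝[≠] t, crossing f φ u = 0 := by
        rw [← nhdsLT_sup_nhdsGT, eventually_sup]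
        exact ⟨hφ.eventually_crossing_eq_zero hf (Or.inr rfl) (hs t _ (Or.inr rfl)),
          hφ.eventually_crossing_eq_zero hf (Or.inl rfl) (hs t _ (Or.inl rfl))⟩
      refine ⟨_, mem_nhdsWithin_of_mem_nhds (eventually_nhdsWithin_iff.1 h1), ?_⟩
      refine (Set.finite_singleton t).subset fun u hu => ?_
      by_contra hut
      exact hu.2 (hu.1 hut)
  exact key.subset fun t ht => ⟨Set.Ico_subset_Icc_self ht.1, ht.2⟩

end IsUnwrappedPhase

/-! ### Sums of jumps of step functions -/

theorem eq_of_eventually_eq_nhdsLT {v : ℝ → ℚ} {t : ℝ} {a b : ℚ} (ha : ∀ᶠ u in 𝓝[<] t, v u = a)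
    (hb : ∀ᶠ u in 𝓝[<] t, v u = b) : a = b := by
  obtain ⟨u, h1, h2⟩ := (ha.and hb).exists
  exact h1.symm.trans h2

/-- The local form of `finsum_jumps`: in a small window around `t`, only `t` can be a jump. -/
theorem exists_pos_finsum_jumps {v vl J : ℝ → ℚ} (hl : ∀ t, ∀ᶠ u in 𝓝[<] t, v u = vl t)
    (hr : ∀ t, ∀ᶠ u in 𝓝[>] t, v u = vl t + J t) (t : ℝ) :
    ∃ δ > 0, ∀ x y, t - δ < x → x ≤ y → y < t + δ →
      (Set.Ico x y ∩ Function.support J).Finite ∧ ∑ᶠ u ∈ Set.Ico x y, J u = vl y - vl x := by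
  obtain ⟨a, ha, hat⟩ := mem_nhdsLT_iff_exists_Ioo_subset.1 (hl t)
  obtain ⟨b, hb, hbt⟩ := mem_nhdsGT_iff_exists_Ioo_subset.1 (hr t)
  have ha : a < t := ha
  have hb : t < b := hb
  have vl_left : ∀ u, a < u → u ≤ t → vl u = vl t := fun u h1 h2 =>
    eq_of_eventually_eq_nhdsLT (hl u) (by
      filter_upwards [Ioo_mem_nhdsLT h1] with w hw using hat ⟨hw.1, hw.2.trans_le h2⟩)
  have vl_right : ∀ u, t < u → u < b → vl u = vl t + J t := fun u h1 h2 =>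
    eq_of_eventually_eq_nhdsLT (hl u) (by
      filter_upwards [Ioo_mem_nhdsLT h1] with w hw using hbt ⟨hw.1, hw.2.trans h2⟩)
  have hJ : ∀ u, a < u → u < b → u ≠ t → J u = 0 := by
    intro u h1 h2 h3
    rcases lt_or_gt_of_ne h3 with h | h
    · have hev : ∀ᶠ w in 𝓝[>] u, v w = vl t := by
        filter_upwards [Ioo_mem_nhdsGT h] with w hw using hat ⟨h1.trans hw.1, hw.2⟩
      obtain ⟨w, e1, e2⟩ := (hev.and (hr u)).exists
      linarith [vl_left u h1 h.le]
    · have hev : ∀ᶠ w in 𝓝[>] u, v w = vl t + J t := by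
        filter_upwards [Ioo_mem_nhdsGT h2] with w hw using hbt ⟨h.trans hw.1, hw.2⟩
      obtain ⟨w, e1, e2⟩ := (hev.and (hr u)).exists
      linarith [vl_right u h h2]
  refine ⟨min (t - a) (b - t), lt_min (by linarith) (by linarith), fun x y hx hxy hy => ?_⟩
  have hxa : a < x := by linarith [min_le_left (t - a) (b - t)]
  have hyb : y < b := by linarith [min_le_right (t - a) (b - t)]
  refine ⟨(Set.finite_singleton t).subset fun u hu => ?_, ?_⟩
  · by_contra hut
    exact hu.2 (hJ u (hxa.trans_le hu.1.1) (hu.1.2.trans hyb) hut)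
  rcases le_or_gt y t with h1 | h1
  · rw [finsum_mem_of_eqOn_zero fun u hu =>
      hJ u (hxa.trans_le hu.1) (hu.2.trans hyb) (hu.2.trans_le h1).ne,
      vl_left x hxa (hxy.trans h1), vl_left y (hxa.trans_le hxy) h1, sub_self]
  rcases lt_or_ge t x with h2 | h2
  · rw [finsum_mem_of_eqOn_zero fun u hu =>
      hJ u (hxa.trans_le hu.1) (hu.2.trans hyb) (h2.trans_le hu.1).ne',
      vl_right x h2 (hxy.trans_lt hyb), vl_right y h1 hyb, sub_self]
  · rw [finsum_mem_inter_support_eq J (Set.Ico x y) {t}, finsum_mem_singleton,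
      vl_left x hxa h2, vl_right y h1 hyb]
    · ring
    · ext u
      constructor
      · rintro ⟨h3, h4⟩
        refine ⟨?_, h4⟩
        by_contra hut
        exact h4 (hJ u (hxa.trans_le h3.1) (h3.2.trans hyb) hut)
      · rintro ⟨h3, h4⟩
        have h3 : u = t := h3
        subst h3
        exact ⟨⟨h2, h1⟩, h4⟩

/-- A step function with left limits `vl` changes by the sum of its jumps `J`. -/
theorem finsum_jumps {v vl J : ℝ → ℚ} (hl : ∀ t, ∀ᶠ u in 𝓝[<] t, v u = vl t)
    (hr : ∀ t, ∀ᶠ u in 𝓝[>] t, v u = vl t + J t) {x y : ℝ} (hxy : x ≤ y) :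
    ∑ᶠ u ∈ Set.Ico x y, J u = vl y - vl x := by
  choose δ hδ hloc using exists_pos_finsum_jumps hl hr
  obtain ⟨s, hs0, hmono, ⟨n, hn⟩, hsub⟩ := exists_monotone_Icc_subset_open_cover_Icc hxy
    (c := fun t : ℝ => (Subtype.val ⁻¹' Set.Ioo (t - δ t) (t + δ t) : Set (Set.Icc x y)))
    (fun t => isOpen_Ioo.preimage continuous_subtype_val)
    (fun u _ => Set.mem_iUnion.2 ⟨u, by linarith [hδ u], by linarith [hδ u]⟩)
  have key : ∀ k, (Set.Ico x (s k) ∩ Function.support J).Finite ∧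
      ∑ᶠ u ∈ Set.Ico x (s k : ℝ), J u = vl (s k) - vl x := by
    intro k
    induction k with
    | zero => simp [hs0]
    | succ k ih =>
      have hk : s k ≤ s (k + 1) := hmono k.le_succ
      have hk' : (s k : ℝ) ≤ s (k + 1) := hk
      obtain ⟨t, ht⟩ := hsub k
      obtain ⟨h1, h2⟩ := hloc t (s k) (s (k + 1)) (ht (Set.left_mem_Icc.2 hk)).1 hk'
        (ht (Set.right_mem_Icc.2 hk)).2
      rw [← Set.Ico_union_Ico_eq_Ico (s k).2.1 hk']
      refine ⟨?_, ?_⟩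
      · rw [Set.union_inter_distrib_right]
        exact ih.1.union h1
      · rw [finsum_mem_union' Set.Ico_disjoint_Ico_same ih.1 h1, ih.2, h2]
        ring
  have := (key n).2
  rwa [hn n le_rfl] at this

/-! ### The crossing sum as a winding number -/

/-- The floor function normalized by its mean value at the integers; rounding a phase in this way
makes entering and leaving a ray count one half each. -/
noncomputable def symmFloor (x : ℝ) : ℚ := ((⌊x⌋ + ⌈x⌉ : ℤ) : ℚ) / 2

theorem symmFloor_intCast (n : ℤ) : symmFloor n = n := by
  simp [symmFloor]

theorem symmFloor_of_lt {x : ℝ} {n : ℤ} (h1 : (n : ℝ) < x) (h2 : x < n + 1) :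
    symmFloor x = n + 1 / 2 := by
  have h3 : ⌊x⌋ = n := Int.floor_eq_iff.2 ⟨h1.le, h2⟩
  have h4 : ⌈x⌉ = n + 1 := Int.ceil_eq_iff.2 ⟨by push_cast; linarith, by push_cast; linarith⟩
  rw [symmFloor, h3, h4]
  push_cast
  ring

theorem symmFloor_sub_intCast (x : ℝ) (n : ℤ) : symmFloor (x - n) = symmFloor x - n := by
  rw [symmFloor, symmFloor, Int.floor_sub_intCast, Int.ceil_sub_intCast]
  push_cast
  ring

/-- On each side of a ray, the rounded phase of `f + 1` is determined by the side on which the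
Nichols plot lies. This works because `f` and `f + 1` have the same imaginary part. -/
theorem IsUnwrappedPhase.eventually_symmFloor_eq {f : ℝ → ℂ} {φ : ℝ → ℝ}
    (hφ : IsUnwrappedPhase f φ) (hf : Continuous f) {ψ : ℝ → ℝ} {m : ℤ}
    (hψ : IsPhase (fun t => f t + 1) ψ m) {t : ℝ} (ht : OnRay f φ t) {k : ℤ}
    (hk : ψ t = -Real.pi + 2 * Real.pi * k) {l : Filter ℝ} (hl : IsSide l t)
    (hs : HasSign (fun u => (f u).im) l) :
    ∀ᶠ u in l, symmFloor (ψ u / (2 * Real.pi) + 1 / 2) = k + (side φ l t : ℚ) / 2 := by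
  have hpi := Real.pi_pos
  have h0 : f t + 1 ≠ 0 := fun h => by
    have h1 := ((hφ.onRay_iff t).1 ht).2
    have h2 := congrArg Complex.re h
    simp at h2
    linarith
  have hψc := hψ.continuousAt t h0
  have hev := (eventually_im_sign_iff hψ.polar h0 (hf.add continuous_const).continuousAt hψc
    hk).filter_mono hl.le_nhds
  have hlo : ∀ᶠ u in l, ψ t - 2 * Real.pi < ψ u :=
    (hψc.eventually_const_lt (by linarith)).filter_mono hl.le_nhds
  have hhi : ∀ᶠ u in l, ψ u < ψ t + 2 * Real.pi :=
    (hψc.eventually_lt_const (by linarith)).filter_mono hl.le_nhds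
  have him : ∀ u, (f u + 1).im = (f u).im := fun u => by simp
  simp only [him] at hev
  obtain ⟨h1, h2, h3⟩ := hφ.side_eq hf ht hl
  have e : ∀ u, ψ u / (2 * Real.pi) + 1 / 2 = k + (ψ u - ψ t) / (2 * Real.pi) := fun u => by
    rw [hk]
    field_simp
    ring
  rcases hs with H | H | H
  · rw [h1 H]
    filter_upwards [H, hev, hlo] with u g1 g2 g3
    have g4 := g2.1.1 g1
    rw [e, symmFloor_of_lt (n := k - 1)]
    · push_cast
      ring
    · have : -1 < (ψ u - ψ t) / (2 * Real.pi) := by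
        rw [lt_div_iff₀ (by linarith)]
        linarith
      push_cast
      linarith
    · have : (ψ u - ψ t) / (2 * Real.pi) < 0 := div_neg_of_neg_of_pos (by linarith) (by linarith)
      push_cast
      linarith
  · rw [h2 H]
    filter_upwards [H, hev, hhi] with u g1 g2 g3
    have g4 := g2.2.1 g1
    rw [e, symmFloor_of_lt (n := k)]
    · push_cast
      ring
    · have : 0 < (ψ u - ψ t) / (2 * Real.pi) := div_pos (by linarith) (by linarith)
      linarith
    · have : (ψ u - ψ t) / (2 * Real.pi) < 1 := by
        rw [div_lt_one (by linarith)]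
        linarith
      linarith
  · rw [h3 H]
    filter_upwards [H, hev] with u g1 g2
    have g3 : ψ u = ψ t := by
      rw [g1] at g2
      exact le_antisymm (not_lt.1 fun h => lt_irrefl _ (g2.2.2 h))
        (not_lt.1 fun h => lt_irrefl _ (g2.1.2 h))
    rw [e, g3, sub_self, zero_div, add_zero, symmFloor_intCast]
    simp

/-- The crossings of the rays, counted along the phase of `f`, add up to the number of clockwise
turns of `f` around `-1`, counted along the phase of `f + 1`. -/
theorem IsUnwrappedPhase.crossingSum_eq {f : ℝ → ℂ} {φ : ℝ → ℝ} (hφ : IsUnwrappedPhase f φ)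
    (hf : Continuous f) (hs : ∀ t l, IsSide l t → HasSign (fun u => (f u).im) l)
    (hne : ∀ t, f t ≠ -1) {ψ : ℝ → ℝ} {m : ℤ} (hψ : IsPhase (fun t => f t + 1) ψ m) :
    crossingSum f φ = m := by
  have hpi := Real.pi_pos
  have h0 : ∀ t, f t + 1 ≠ 0 := fun t h => hne t (eq_neg_of_add_eq_zero_left h)
  have hψc : ∀ t, ContinuousAt ψ t := fun t => hψ.continuousAt t (h0 t)
  have hloc : ∀ t, ∃ a : ℚ,
      (∀ᶠ u in 𝓝[<] t, symmFloor (ψ u / (2 * Real.pi) + 1 / 2) = a) ∧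
      (∀ᶠ u in 𝓝[>] t, symmFloor (ψ u / (2 * Real.pi) + 1 / 2) = a + -crossing f φ t) := by
    intro t
    have hcut : (∃ k : ℤ, ψ t = -Real.pi + 2 * Real.pi * k) ↔ OnRay f φ t := by
      rw [← re_neg_iff_phase (h0 t) (hψ.polar t), hφ.onRay_iff, Complex.add_im, Complex.one_im,
        add_zero, Complex.add_re, Complex.one_re, ← lt_neg_iff_add_neg]
    by_cases hr : OnRay f φ t
    · obtain ⟨k, hk⟩ := hcut.2 hr
      refine ⟨_, hφ.eventually_symmFloor_eq hf hψ hr hk (Or.inr rfl) (hs t _ (Or.inr rfl)), ?_⟩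
      filter_upwards [hφ.eventually_symmFloor_eq hf hψ hr hk (Or.inl rfl) (hs t _ (Or.inl rfl))]
        with u hu
      rw [hu, crossing, if_pos hr]
      push_cast
      ring
    · have hn : ¬ ∃ k : ℤ, ψ t / (2 * Real.pi) + 1 / 2 = k := by
        rintro ⟨k, hk⟩
        refine hr (hcut.1 ⟨k, ?_⟩)
        field_simp at hk
        linarith
      have h1 : ((⌊ψ t / (2 * Real.pi) + 1 / 2⌋ : ℤ) : ℝ) < ψ t / (2 * Real.pi) + 1 / 2 :=
        lt_of_le_of_ne (Int.floor_le _) fun h => hn ⟨_, h.symm⟩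
      have hc : ContinuousAt (fun u => ψ u / (2 * Real.pi) + 1 / 2) t :=
        ((hψc t).div_const _).add continuousAt_const
      have hev : ∀ᶠ u in 𝓝 t, symmFloor (ψ u / (2 * Real.pi) + 1 / 2)
          = ⌊ψ t / (2 * Real.pi) + 1 / 2⌋ + 1 / 2 := by
        filter_upwards [hc.eventually_const_lt h1, hc.eventually_lt_const (Int.lt_floor_add_one _)]
          with u g1 g2 using symmFloor_of_lt g1 g2
      refine ⟨_, hev.filter_mono nhdsWithin_le_nhds, ?_⟩
      rw [crossing, if_neg hr, neg_zero, add_zero]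
      exact hev.filter_mono nhdsWithin_le_nhds
  choose vl hl hr using hloc
  have hsum := finsum_jumps hl hr zero_le_one
  have hvl : vl 1 = vl 0 - m := by
    have hshift : Tendsto (fun u : ℝ => u + 1) (𝓝[<] 0) (𝓝[<] 1) := by
      refine tendsto_nhdsWithin_iff.2 ⟨?_, ?_⟩
      · have : Tendsto (fun u : ℝ => u + 1) (𝓝 0) (𝓝 (0 + 1)) :=
          tendsto_id.add tendsto_const_nhds
        rw [zero_add] at this
        exact this.mono_left nhdsWithin_le_nhds
      · filter_upwards [self_mem_nhdsWithin] with u hu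
        have hu : u < 0 := hu
        change u + 1 < 1
        linarith
    obtain ⟨u, h1, h2⟩ := ((hshift.eventually (hl 1)).and (hl 0)).exists
    rw [← h1, ← h2, hψ.turn u, ← symmFloor_sub_intCast]
    congr 1
    field_simp
    ring
  have hneg : ∑ᶠ u ∈ Set.Ico (0 : ℝ) 1, -crossing f φ u = -crossingSum f φ := by
    simp only [crossingSum, finsum_neg_distrib]
  rw [hneg, hvl] at hsum
  linarith

/-! ### The Nyquist criterion -/

/-- The argument principle for `1 + L` on the Nyquist contour: its phase makes `Z - n` clockwise
turns, where `Z` and `n` count its zeros and poles in the open right half plane. -/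
theorem exists_isPhase_one_add {L : RatFunc ℝ} {S : Finset ℂ} {R ε : ℝ} (h : Clear L S R ε)
    (hS : ∀ z ∈ (L.denom + L.num).aroots ℂ, z ∈ S) :
    ∃ ψ, IsPhase (fun t => nyquistPlot L R ε t + 1) ψ
      (((L.denom + L.num).aroots ℂ).countP (fun z => 0 < z.re) - unstablePoleCount L) := by
  obtain ⟨θ, hθ⟩ := exists_isPhase_eval (nyquistContour L R ε)
    ((L.denom + L.num).map (algebraMap ℝ ℂ)) fun z hz => h.exists_isPhase_sub (hS z hz)
  obtain ⟨η, hη⟩ := exists_isPhase_eval (nyquistContour L R ε)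
    (L.denom.map (algebraMap ℝ ℂ)) fun z hz => h.exists_isPhase_sub
      (h.poles_mem z (Polynomial.mem_aroots.1 hz).2)
  refine ⟨fun t => θ t + -η t, ?_⟩
  convert hθ.mul hη.inv using 1
  · funext t
    have h0 := h.denom_contour_ne t
    rw [nyquistPlot, RatFunc.eval, Polynomial.eval_map, Polynomial.eval_map, Polynomial.eval₂_add]
    rw [Polynomial.aeval_def] at h0
    field_simp
    ring
  · exact sub_eq_add_neg _ _

theorem exists_isUnwrappedPhase {L : RatFunc ℝ} {S : Finset ℂ} {R ε : ℝ} (h : Clear L S R ε)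
    (hS : ∀ z ∈ L.num.aroots ℂ, z ∈ S) :
    ∃ φ, IsUnwrappedPhase (nyquistPlot L R ε) φ := by
  obtain ⟨θ, hθ⟩ := exists_isPhase_eval (nyquistContour L R ε)
    (L.num.map (algebraMap ℝ ℂ)) fun z hz => h.exists_isPhase_sub (hS z hz)
  obtain ⟨η, hη⟩ := exists_isPhase_eval (nyquistContour L R ε)
    (L.denom.map (algebraMap ℝ ℂ)) fun z hz => h.exists_isPhase_sub
      (h.poles_mem z (Polynomial.mem_aroots.1 hz).2)
  have hf : (fun t => nyquistPlot L R ε t) = fun t =>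
      (L.num.map (algebraMap ℝ ℂ)).eval (nyquistContour L R ε t) *
        ((L.denom.map (algebraMap ℝ ℂ)).eval (nyquistContour L R ε t))⁻¹ := by
    funext t
    rw [nyquistPlot, RatFunc.eval, Polynomial.eval_map, Polynomial.eval_map, div_eq_mul_inv]
  have hphase := hθ.mul hη.inv
  rw [← hf] at hphase
  refine ⟨fun t => (θ t + -η t) * 180 / Real.pi, fun t _ => ?_, fun t ht => ?_⟩
  · have hpi := Real.pi_ne_zero
    have e : (θ t + -η t) * 180 / Real.pi * Real.pi / 180 = θ t + -η t := by
      field_simp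
    rw [e]
    exact hphase.polar t
  · exact ((hphase.continuousAt t ht).mul_const _).div_const _

/-- The closed-loop poles in the closed right half plane are the zeros there of the numerator of
`1 + L`, because no factor that cancels in the product has a zero there. -/
theorem aeval_characteristicPolynomial_iff {P G : RatFunc ℝ} (hPG : NoUnstableCancellation P G)
    {s : ℂ} (hs : 0 ≤ s.re) :
    Polynomial.aeval s (characteristicPolynomial P G) = 0 ↔
      Polynomial.aeval s ((P * G).denom + (P * G).num) = 0 := by
  obtain ⟨c, hc⟩ := RatFunc.denom_mul_dvd P G
  have hn : P.num * G.num = (P * G).num * c := by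
    have h := RatFunc.num_denom_mul P G
    rw [hc] at h
    refine mul_right_cancel₀ (RatFunc.denom_ne_zero (P * G)) ?_
    rw [← h]
    ring
  have e : characteristicPolynomial P G = ((P * G).denom + (P * G).num) * c := by
    rw [characteristicPolynomial, hc, hn]
    ring
  have hcs : Polynomial.aeval s c ≠ 0 := fun h0 => hPG s hs
    ⟨by rw [hn, map_mul, h0, mul_zero], by rw [hc, map_mul, h0, mul_zero]⟩
  rw [e, map_mul, mul_eq_zero, or_iff_left hcs]

theorem nyquistPlot_eq_neg_one_iff {L : RatFunc ℝ} {S : Finset ℂ} {R ε : ℝ} (h : Clear L S R ε)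
    (t : ℝ) : nyquistPlot L R ε t = -1 ↔
      Polynomial.aeval (nyquistContour L R ε t) (L.denom + L.num) = 0 := by
  have h0 := h.denom_contour_ne t
  change Polynomial.aeval (nyquistContour L R ε t) L.num /
    Polynomial.aeval (nyquistContour L R ε t) L.denom = -1 ↔ _
  rw [div_eq_iff h0, map_add, add_comm, ← eq_neg_iff_add_eq_zero, neg_one_mul]

/-- Avoiding `-1` excludes closed-loop poles on the imaginary axis, so stability becomes the absence
of zeros of `1 + L` in the open right half plane. -/
theorem stable_iff {P G : RatFunc ℝ} (hPG : NoUnstableCancellation P G) {S : Finset ℂ} {R ε : ℝ}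
    (h : Clear (P * G) S R ε) (hS : ∀ z ∈ ((P * G).denom + (P * G).num).aroots ℂ, z ∈ S) :
    ClosedLoopStable P G ↔ (∀ t, nyquistPlot (P * G) R ε t ≠ -1) ∧
      (((P * G).denom + (P * G).num).aroots ℂ).countP (fun z => 0 < z.re) = 0 := by
  have hstab : ClosedLoopStable P G ↔
      ∀ s : ℂ, Polynomial.aeval s ((P * G).denom + (P * G).num) = 0 → s.re < 0 := by
    refine forall_congr' fun s => ?_
    by_cases hs : s.re < 0
    · simp [hs]
    · rw [aeval_characteristicPolynomial_iff hPG (not_lt.1 hs)]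
  rw [hstab, Multiset.countP_eq_zero]
  constructor
  · intro H
    refine ⟨fun t ht => ?_, fun z hz hre => ?_⟩
    · exact (H _ ((nyquistPlot_eq_neg_one_iff h t).1 ht)).not_ge (h.contour_re_nonneg t)
    · exact lt_asymm hre (H z (Polynomial.mem_aroots.1 hz).2)
  · rintro ⟨H1, H2⟩ s hs
    have hne : (P * G).denom + (P * G).num ≠ 0 := fun h0 =>
      H1 0 ((nyquistPlot_eq_neg_one_iff h 0).2 (by rw [h0, map_zero]))
    have hmem : s ∈ ((P * G).denom + (P * G).num).aroots ℂ := Polynomial.mem_aroots.2 ⟨hne, hs⟩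
    refine lt_of_le_of_ne (not_lt.1 (H2 s hmem)) fun hre => ?_
    by_cases hp : s ∈ imaginaryPoles (P * G)
    · -- a common zero of `denom + num` and `denom` contradicts coprimality
      have hd : Polynomial.aeval s (P * G).denom = 0 :=
        (Polynomial.mem_aroots.1 (Multiset.mem_toFinset.1 (Finset.mem_filter.1 hp).1)).2
      obtain ⟨a, b, hab⟩ := RatFunc.isCoprime_num_denom (P * G)
      have hnum : Polynomial.aeval s (P * G).num = 0 := by
        rwa [map_add, hd, zero_add] at hs
      have := congrArg (Polynomial.aeval s) hab
      simp [hd, hnum] at this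
    · obtain ⟨t, ht⟩ := h.exists_contour_eq (hS s hmem) hre hp
      exact H1 t ((nyquistPlot_eq_neg_one_iff h t).2 (by rw [ht, hs]))

end NicholsChart

theorem theorem4 (P G : RatFunc ℝ) (hPG : NicholsChart.NoUnstableCancellation P G)
    (n : ℕ) (hn : NicholsChart.unstablePoleCount (P * G) = n) :
    ∃ R₀ : ℝ, 0 < R₀ ∧ ∃ ε₀ : ℝ, 0 < ε₀ ∧
      ∀ R : ℝ, R₀ < R → ∀ ε : ℝ, 0 < ε → ε < ε₀ →
        (∃ φ : ℝ → ℝ,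
          NicholsChart.IsUnwrappedPhase (NicholsChart.nyquistPlot (P * G) R ε) φ) ∧
        ∀ φ : ℝ → ℝ,
          NicholsChart.IsUnwrappedPhase (NicholsChart.nyquistPlot (P * G) R ε) φ →
          {t ∈ Set.Ico (0 : ℝ) 1 |
            NicholsChart.crossing (NicholsChart.nyquistPlot (P * G) R ε) φ t ≠ 0}.Finite ∧
          ((∀ t, NicholsChart.nyquistPlot (P * G) R ε t ≠ -1) →
            ∃ N : ℤ, NicholsChart.Encircles (NicholsChart.nyquistPlot (P * G) R ε) (-1) N ∧
              NicholsChart.crossingSum (NicholsChart.nyquistPlot (P * G) R ε) φ = N) ∧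
          (NicholsChart.ClosedLoopStable P G ↔
            ¬ NicholsChart.MeetsCriticalPoint (NicholsChart.nyquistPlot (P * G) R ε) φ ∧
              NicholsChart.crossingSum (NicholsChart.nyquistPlot (P * G) R ε) φ = -(n : ℚ)) := by
  classical
  let S : Finset ℂ := ((P * G).denom.aroots ℂ + (P * G).num.aroots ℂ +
    ((P * G).denom + (P * G).num).aroots ℂ).toFinset
  have hSd : ∀ z : ℂ, Polynomial.aeval z (P * G).denom = 0 → z ∈ S := fun z hz => by
    have : z ∈ (P * G).denom.aroots ℂ := Polynomial.mem_aroots.2 ⟨RatFunc.denom_ne_zero _, hz⟩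
    simp only [S, Multiset.mem_toFinset, Multiset.mem_add, this, true_or]
  have hSn : ∀ z ∈ (P * G).num.aroots ℂ, z ∈ S := fun z hz => by
    simp only [S, Multiset.mem_toFinset, Multiset.mem_add, hz, true_or, or_true]
  have hSc : ∀ z ∈ ((P * G).denom + (P * G).num).aroots ℂ, z ∈ S := fun z hz => by
    simp only [S, Multiset.mem_toFinset, Multiset.mem_add, hz, or_true]
  obtain ⟨R₀, hR₀, ε₀, hε₀, H⟩ := NicholsChart.exists_clear (P * G) S hSd
  refine ⟨R₀, hR₀, ε₀, hε₀, fun R hR ε hε hεε => ?_⟩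
  have h := H R hR ε hε hεε
  refine ⟨NicholsChart.exists_isUnwrappedPhase h hSn, fun φ hφ => ?_⟩
  have hcont := h.continuous_nyquistPlot
  have hsign : ∀ t l, NicholsChart.IsSide l t →
      NicholsChart.HasSign (fun u => (NicholsChart.nyquistPlot (P * G) R ε u).im) l :=
    fun t l hl => h.hasSign_nyquistPlot hl
  obtain ⟨ψ, hψ⟩ := NicholsChart.exists_isPhase_one_add h hSc
  rw [hn] at hψ
  refine ⟨hφ.finite_crossing hcont hsign, fun hne => ?_, ?_⟩
  · refine ⟨_, ⟨hne, ψ, ?_, ?_, ?_⟩, hφ.crossingSum_eq hcont hsign hne hψ⟩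
    · exact continuous_iff_continuousAt.2 fun t =>
        hψ.continuousAt t fun h0 => hne t (eq_neg_of_add_eq_zero_left h0)
    · simpa only [sub_neg_eq_add] using hψ.polar
    · have := hψ.turn 0
      rw [zero_add] at this
      linarith
  · rw [NicholsChart.stable_iff hPG h hSc, hφ.meetsCriticalPoint_iff, not_exists]
    refine and_congr_right fun hne => ?_
    rw [hφ.crossingSum_eq hcont hsign hne hψ]
    constructor
    · intro h0
      rw [h0]
      push_cast
      ring
    · intro h0
      push_cast at h0
      have h1 : ((((P * G).denom + (P * G).num).aroots ℂ).countP (fun z => 0 < z.re) : ℚ) = 0 := by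
        linarith
      exact_mod_cast h1
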